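/- Let $X$ be a finite set and let $r\colon X\times X\to X\times X$, $r(x,y)=(\sigma_x(y),\tau_y(x))$, be an invertible non-degenerate solution of the Yang--Baxter equation: $r$ is bijective, all the maps $\sigma_x,\tau_x\colon X\to X$ are bijective, and $r_1r_2r_1=r_2r_1r_2$ on $X\times X\times X$, where $r_1=r\times\operatorname{Id}_X$ and $r_2=\operatorname{Id}_X\times r$. Let \[G_{(X,r)}=\langle X \mid xy=\sigma_x(y)\tau_y(x)\ \text{for all } x,y\in X\rangle\] be its structure group, and let $(X,\lhd_r)$, $x\lhd_r y=\tau_y\sigma_{\tau_x^{-1}(y)}(x)$, be its structure rack. Let $\mathcal O_1,\dots,\mathcal O_{k_r}$ be the orbits of $X$ with respect to all the maps $x\mapsto\sigma_z(x)$ and $x\mapsto\tau_z(x)$, $z\in X$ (the orbits of the solution), and let $K_r$ be the number of orbits of $X$ with respect to the maps $x\mapsto x\lhd_r z$, $z\in X$ (the orbits of the structure rack). Then $G_{(X,r)}$ is bi-orderable (that is, it admits a total order with $a<b\Rightarrow ca<cb$ and $ac<bc$ for all $a,b,c$) if and only if it is free abelian. In this case, 1. the partitions of $X$ into the orbits of the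 solution $(X,r)$ and into the orbits of its structure rack $(X,\lhd_r)$ coincide, and $k_r=K_r$; 2. the group morphism $\nu\colon G_{(X,r)}\to\mathbb Z^{k_r}$ sending every $x$ from the orbit $\mathcal O_i$ to the generator $e_i$ of $\mathbb Z^{k_r}$ is an isomorphism. -/

import Mathlib

universe u

/-- An invertible non-degenerate set-theoretic solution of the
Yang-Baxter equation on `X`. We write `r (x, y) = (σ x y, τ y x)`.
Finiteness of `X` is a separate assumption. -/
structure YBESolution (X : Type u) where
  /-- the map `r : X × X → X × X` -/
  r : X × X → X × X
  /-- `r` is invertible -/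
  r_bijective : Function.Bijective r
  /-- the components `σ x` are invertible -/
  left_bijective : ∀ x : X, Function.Bijective fun y : X => (r (x, y)).1
  /-- the components `τ y` are invertible -/
  right_bijective : ∀ y : X, Function.Bijective fun x : X => (r (x, y)).2
  /-- the Yang-Baxter equation `r₁ r₂ r₁ = r₂ r₁ r₂` on triples,
  where `r₁ = r × Id` and `r₂ = Id × r` -/
  yang_baxter :
    let r₁ : X × X × X → X × X × X :=
      fun t => ((r (t.1, t.2.1)).1, (r (t.1, t.2.1)).2, t.2.2)
    let r₂ : X × X × X → X × X × X := fun t => (t.1, r t.2)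
    r₁ ∘ r₂ ∘ r₁ = r₂ ∘ r₁ ∘ r₂

namespace YBESolution

variable {X : Type u} (S : YBESolution X)

/-- The permutation `σ x` of `X`: `r (x, y) = (σ x y, τ y x)`. -/
noncomputable def σ (x : X) : Equiv.Perm X :=
  Equiv.ofBijective (fun y => (S.r (x, y)).1) (S.left_bijective x)

/-- The permutation `τ y` of `X`: `r (x, y) = (σ x y, τ y x)`. -/
noncomputable def τ (y : X) : Equiv.Perm X :=
  Equiv.ofBijective (fun x => (S.r (x, y)).2) (S.right_bijective y)

/-- The relators `x y (σ_x(y) τ_y(x))⁻¹` of the structure group. -/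
def structureRels : Set (FreeGroup X) :=
  {w | ∃ x y : X, w = FreeGroup.of x * FreeGroup.of y *
    (FreeGroup.of (S.σ x y) * FreeGroup.of (S.τ y x))⁻¹}

/-- The structure group `⟨ X | x y = σ_x(y) τ_y(x) for all x, y ∈ X ⟩`. -/
abbrev StructureGroup : Type u := PresentedGroup S.structureRels

/-- The natural map `X → G_{(X,r)}`. -/
def ι (x : X) : S.StructureGroup := PresentedGroup.of x

/-- The operation of the (right) structure rack, `x ◁ y = τ_y (σ_{τ_x⁻¹(y)} (x))`. -/
noncomputable def rackOp (x y : X) : X := S.τ y (S.σ ((S.τ x).symm y) x)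

/-- The partition of `X` into orbits of the solution, for the maps `x ↦ σ_z(x)`, `x ↦ τ_z(x)`.
Since these maps are bijective, the orbits of the group that they generate
are the classes of the smallest equivalence relation
that relates each point to its images. -/
def orbitSetoid : Setoid X :=
  Relation.EqvGen.setoid fun x x' => ∃ z : X, x' = S.σ z x ∨ x' = S.τ z x

/-- The partition of `X` into orbits of the structure rack, for the right translations
`x ↦ x ◁ z`. -/
def rackOrbitSetoid : Setoid X :=
  Relation.EqvGen.setoid fun x x' => ∃ z : X, x' = S.rackOp x z

/-- The set of orbits of the solution. -/
abbrev Orbits : Type u := Quotient S.orbitSetoid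

/-- The set of orbits of the structure rack. -/
abbrev RackOrbits : Type u := Quotient S.rackOrbitSetoid

/-- The orbit of an element of the solution. -/
def orbitOf (x : X) : S.Orbits := Quotient.mk S.orbitSetoid x

/-- The number `k_r` of orbits of the solution. -/
noncomputable def numOrbits : ℕ := Nat.card S.Orbits

/-- The number `K_r` of orbits of the structure rack. -/
noncomputable def numRackOrbits : ℕ := Nat.card S.RackOrbits

theorem orbitOf_σ (x y : X) : S.orbitOf (S.σ x y) = S.orbitOf y :=
  (Quotient.sound (s := S.orbitSetoid) (Relation.EqvGen.rel _ _ ⟨x, Or.inl rfl⟩)).symm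

theorem orbitOf_τ (x y : X) : S.orbitOf (S.τ y x) = S.orbitOf x :=
  (Quotient.sound (s := S.orbitSetoid) (Relation.EqvGen.rel _ _ ⟨y, Or.inr rfl⟩)).symm

/-- Given an enumeration `e` of the orbits by `Fin k_r`, the group morphism
`G_{(X,r)} → ℤ^{k_r}` that sends each generator `x` lying in the orbit number `i`
to the basis vector `e_i`. -/
noncomputable def ν (e : S.Orbits ≃ Fin S.numOrbits) :
    S.StructureGroup →* Multiplicative (Fin S.numOrbits → ℤ) :=
  PresentedGroup.toGroup
    (f := fun x => Multiplicative.ofAdd (Pi.single (e (S.orbitOf x)) (1 : ℤ))) <| by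
      rintro w ⟨x, y, rfl⟩
      simp only [map_mul, map_inv, FreeGroup.lift_apply_of, orbitOf_σ, orbitOf_τ]
      rw [mul_inv_eq_one, mul_comm]

theorem ν_ι (e : S.Orbits ≃ Fin S.numOrbits) (x : X) :
    S.ν e (S.ι x) = Multiplicative.ofAdd (Pi.single (e (S.orbitOf x)) (1 : ℤ)) :=
  PresentedGroup.toGroup.of _

end YBESolution

/-- A group is bi-orderable if it has a total order that is stable under left and right
translations. -/
def IsBiOrderable (G : Type u) [Group G] : Prop :=
  ∃ _ : LinearOrder G, ∀ a b c : G, a < b → c * a < c * b ∧ a * c < b * c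

/-- A (multiplicative) group is free abelian if it is isomorphic to a direct sum of copies
of `ℤ`. -/
def IsFreeAbelian (G : Type u) [Group G] : Prop :=
  ∃ I : Type u, Nonempty (G ≃* Multiplicative (I →₀ ℤ))

/-! In a bi-ordered group roots are unique, so elements with commuting nonzero powers commute. A
power of `ι x` acts trivially through `σ`. Words of fixed length with trivial action form a finite
set stable under conjugation by generators, so some power of each `ι y` commutes with that power of
`ι x`; hence the group is abelian (`commute_ι`). The order and finiteness then force `ι` to be
constant on orbits (`ι_τ`, `ι_σ_of_ι_τ`), which yields an inverse of `ν`. An affine action on the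
free abelian group on the rack orbits shows that `ι` separates these orbits, so both partitions
agree. Conversely, a lexicographic order bi-orders a free abelian group. -/

theorem commute_of_commute_pow {G : Type*} [Group G] [IsMulTorsionFree G] {a b : G} {n : ℕ}
    (hn : n ≠ 0) (h : Commute (a ^ n) b) : Commute a b := by
  have h' : (b⁻¹ * a * b⁻¹⁻¹) ^ n = a ^ n := by
    rw [conj_pow, inv_inv, mul_assoc, h.eq, inv_mul_cancel_left]
  have h'' := pow_left_injective hn h'
  rw [inv_inv, mul_assoc, inv_mul_eq_iff_eq_mul] at h''
  exact h''

namespace YBESolution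

variable {X : Type u} (S : YBESolution X)

theorem σ_comp (x y z : X) : S.σ x (S.σ y z) = S.σ (S.σ x y) (S.σ (S.τ y x) z) :=
  (congrArg Prod.fst (congrFun S.yang_baxter (x, y, z))).symm

theorem τ_σ_comp (x y z : X) :
    S.τ (S.σ (S.τ y x) z) (S.σ x y) = S.σ (S.τ (S.σ y z) x) (S.τ z y) :=
  congrArg (fun t => t.2.1) (congrFun S.yang_baxter (x, y, z))

theorem τ_comp (x y z : X) : S.τ z (S.τ y x) = S.τ (S.τ z y) (S.τ (S.σ y z) x) :=
  congrArg (fun t => t.2.2) (congrFun S.yang_baxter (x, y, z))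

theorem ι_mul_ι (x y : X) : S.ι x * S.ι y = S.ι (S.σ x y) * S.ι (S.τ y x) := by
  have h : PresentedGroup.mk S.structureRels (FreeGroup.of x * FreeGroup.of y *
      (FreeGroup.of (S.σ x y) * FreeGroup.of (S.τ y x))⁻¹) = 1 :=
    PresentedGroup.one_of_mem ⟨x, y, rfl⟩
  rw [map_mul, map_inv, mul_inv_eq_one, map_mul, map_mul] at h
  exact h

/-! ### Commutativity of the generators -/

/-- The left action of the structure group on `X` by the maps `σ x`. -/
noncomputable def σHom : S.StructureGroup →* Equiv.Perm X :=
  PresentedGroup.toGroup (f := S.σ) <| by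
    rintro w ⟨x, y, rfl⟩
    simp only [map_mul, map_inv, FreeGroup.lift_apply_of]
    rw [mul_inv_eq_one]
    ext z
    exact S.σ_comp x y z

theorem σHom_ι (x : X) : S.σHom (S.ι x) = S.σ x :=
  PresentedGroup.toGroup.of _

/-- The defining relations carry `y` leftwards past each letter of the word and preserve its length.
-/
theorem exists_prod_mul_ι (l : List X) (y : X) : ∃ l' : List X, l'.length = l.length ∧
    (l.map S.ι).prod * S.ι y = S.ι (S.σHom (l.map S.ι).prod y) * (l'.map S.ι).prod := by
  induction l with
  | nil => exact ⟨[], rfl, by simp⟩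
  | cons x l ih =>
    obtain ⟨l', hl, h⟩ := ih
    refine ⟨S.τ (S.σHom (l.map S.ι).prod y) x :: l', by simp [hl], ?_⟩
    simp only [List.map_cons, List.prod_cons, map_mul, σHom_ι, Equiv.Perm.mul_apply]
    rw [mul_assoc, h, ← mul_assoc, ι_mul_ι, mul_assoc]

/-- The elements that are products of `n` generators and act trivially on `X` through `σ`. -/
def trivialWords (n : ℕ) : Set S.StructureGroup :=
  {g | S.σHom g = 1 ∧ ∃ l : List X, l.length = n ∧ (l.map S.ι).prod = g}

theorem finite_trivialWords [Finite X] (n : ℕ) : (S.trivialWords n).Finite :=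
  ((List.finite_length_eq X n).image fun l => (l.map S.ι).prod).subset
    fun _ ⟨_, l, hl, h⟩ => ⟨l, hl, h⟩

/-- A word with trivial action lets `y` pass unchanged, so its conjugate is again a word of the same
length. -/
theorem conj_mem_trivialWords {n : ℕ} {g : S.StructureGroup} (hg : g ∈ S.trivialWords n) (y : X) :
    (S.ι y)⁻¹ * g * S.ι y ∈ S.trivialWords n := by
  obtain ⟨h1, l, hl, rfl⟩ := hg
  obtain ⟨l', hl', h⟩ := S.exists_prod_mul_ι l y
  refine ⟨by simp [h1], l', hl'.trans hl, ?_⟩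
  rw [mul_assoc, h, h1]
  simp

/-- Pigeonhole: the conjugates of `g` by the powers of `ι y` stay in a finite set, so two of them
coincide. -/
theorem exists_commute_pow_of_mem_trivialWords [Finite X] {n : ℕ} {g : S.StructureGroup}
    (hg : g ∈ S.trivialWords n) (y : X) : ∃ m ≠ 0, Commute g (S.ι y ^ m) := by
  have key (k : ℕ) : (S.ι y ^ k)⁻¹ * g * S.ι y ^ k ∈ S.trivialWords n := by
    induction k with
    | zero => simpa using hg
    | succ k ih => simpa [pow_succ, mul_assoc] using S.conj_mem_trivialWords ih y
  have := (S.finite_trivialWords n).to_subtype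
  obtain ⟨i, j, hij, h⟩ := Finite.exists_ne_map_eq_of_infinite
    fun k => (⟨_, key k⟩ : S.trivialWords n)
  wlog hlt : i < j generalizing i j
  · exact this j i hij.symm h.symm (by lia)
  obtain ⟨k, rfl⟩ := Nat.exists_eq_add_of_lt hlt
  refine ⟨k + 1, by simp, ?_⟩
  have h' := congrArg Subtype.val h
  simp only at h'
  rw [add_assoc, add_comm, pow_add, mul_inv_rev] at h'
  have h'' : g = (S.ι y ^ (k + 1))⁻¹ * g * S.ι y ^ (k + 1) := by
    have assoc (a b : S.StructureGroup) : a⁻¹ * b⁻¹ * g * (b * a) = a⁻¹ * (b⁻¹ * g * b) * a := by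
      simp only [mul_assoc]
    rw [assoc] at h'
    exact mul_left_cancel (mul_right_cancel h')
  rw [mul_assoc, eq_inv_mul_iff_mul_eq] at h''
  exact h''.symm

theorem commute_ι [Finite X] [IsMulTorsionFree S.StructureGroup] (x y : X) :
    Commute (S.ι x) (S.ι y) := by
  obtain ⟨n, hn, hx⟩ := (isOfFinOrder_of_finite (S.σ x)).exists_pow_eq_one
  have hg : S.ι x ^ n ∈ S.trivialWords n :=
    ⟨by rw [map_pow, σHom_ι, hx], List.replicate n x, by simp, by simp⟩
  obtain ⟨m, hm, h⟩ := S.exists_commute_pow_of_mem_trivialWords hg y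
  -- Unique roots are used twice, once for each exponent.
  exact commute_of_commute_pow hn.ne' (commute_of_commute_pow hm h.symm).symm

/-! ### Constancy of `ι` on orbits -/

/-- If `ι x` dominates all the `ι (τ z x)`, then it is equal to all of them. -/
theorem ι_τ_eq_of_forall_le [Finite X] [LinearOrder S.StructureGroup]
    [MulLeftStrictMono S.StructureGroup]
    (hc : ∀ x y, Commute (S.ι x) (S.ι y)) {x : X}
    (hx : ∀ z, S.ι (S.τ z x) ≤ S.ι x) (y : X) : S.ι (S.τ y x) = S.ι x := by
  have := mulLeftMono_of_mulLeftStrictMono S.StructureGroup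
  -- In `x z = σ_x(z) τ_z(x)` the factor `τ_z(x)` is at most `x`, so `σ_x(z)` is at least `z`. The
  -- cycles of `σ_x` are finite, which forces equality.
  have step (z : X) : S.ι z ≤ S.ι (S.σ x z) := by
    have h : S.ι x * S.ι z ≤ S.ι x * S.ι (S.σ x z) := by
      rw [ι_mul_ι, (hc x (S.σ x z)).eq]
      exact mul_le_mul_right (hx z) _
    exact (mul_le_mul_iff_left _).1 h
  have iter (k : ℕ) (z : X) : S.ι z ≤ S.ι ((S.σ x ^ k) z) := by
    induction k with
    | zero => rfl
    | succ k ih => exact ih.trans (by simpa [pow_succ'] using step _)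
  obtain ⟨n, hn, hxn⟩ := (isOfFinOrder_of_finite (S.σ x)).exists_pow_eq_one
  obtain ⟨m, rfl⟩ := Nat.exists_eq_succ_of_ne_zero hn.ne'
  have heq : S.ι (S.σ x y) = S.ι y := by
    refine le_antisymm ?_ (step y)
    have h := iter m (S.σ x y)
    rwa [← Equiv.Perm.mul_apply, ← pow_succ, hxn] at h
  have h := S.ι_mul_ι x y
  rw [heq, (hc x y).eq] at h
  exact (mul_left_cancel h).symm

theorem ι_τ [Finite X] [LinearOrder S.StructureGroup]
    [MulLeftStrictMono S.StructureGroup] (hc : ∀ x y, Commute (S.ι x) (S.ι y)) (x y : X) :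
    S.ι (S.τ y x) = S.ι x := by
  -- The induction descends from the largest values of `ι`: the claim for `x` may use it for every
  -- point with larger image.
  have wf : WellFounded fun a b : X => S.ι b < S.ι a := by
    have : IsTrans X fun a b => S.ι b < S.ι a := ⟨fun _ _ _ h h' => h'.trans h⟩
    have : Std.Irrefl fun a b : X => S.ι b < S.ι a := ⟨fun _ => lt_irrefl _⟩
    exact Finite.wellFounded_of_trans_of_irrefl _
  induction x using wf.induction generalizing y with
  | _ x ih =>
  refine S.ι_τ_eq_of_forall_le hc (fun z => ?_) y
  by_contra! hlt
  -- Once `ι` exceeds `ι x`, it stays constant along the cycle of `τ z`; but this cycle returns to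
  -- `x`.
  have iter (k : ℕ) : S.ι ((S.τ z ^ k) (S.τ z x)) = S.ι (S.τ z x) := by
    induction k with
    | zero => rfl
    | succ k hk =>
      rw [pow_succ', Equiv.Perm.mul_apply, ih _ (hk ▸ hlt), hk]
  obtain ⟨n, hn, hzn⟩ := (isOfFinOrder_of_finite (S.τ z)).exists_pow_eq_one
  obtain ⟨m, rfl⟩ := Nat.exists_eq_succ_of_ne_zero hn.ne'
  have h := iter m
  rw [← Equiv.Perm.mul_apply, ← pow_succ, hzn] at h
  exact hlt.ne h

theorem ι_σ_of_ι_τ (hc : ∀ x y, Commute (S.ι x) (S.ι y)) (hτ : ∀ x y, S.ι (S.τ y x) = S.ι x)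
    (x y : X) : S.ι (S.σ x y) = S.ι y := by
  have h := S.ι_mul_ι x y
  rw [hτ, (hc x y).eq] at h
  exact (mul_right_cancel h).symm

theorem mul_comm_of_commute_ι (hc : ∀ x y, Commute (S.ι x) (S.ι y)) (a b : S.StructureGroup) :
    a * b = b * a := by
  have h (x : X) (b : S.StructureGroup) : b ∈ Subgroup.centralizer {S.ι x} :=
    PresentedGroup.generated_by _ _
      (fun y => Subgroup.mem_centralizer_singleton_iff.2 (hc y x).eq) b
  have h' : a ∈ Subgroup.centralizer {b} := PresentedGroup.generated_by _ _
    (fun x => Subgroup.mem_centralizer_singleton_iff.2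
      (Subgroup.mem_centralizer_singleton_iff.1 (h x b)).symm) a
  exact Subgroup.mem_centralizer_singleton_iff.1 h'

/-! ### The morphism `ν` -/

theorem ν_bijective (hc : ∀ x y, Commute (S.ι x) (S.ι y)) (hτ : ∀ x y, S.ι (S.τ y x) = S.ι x)
    (e : S.Orbits ≃ Fin S.numOrbits) : Function.Bijective (S.ν e) := by
  let : CommGroup S.StructureGroup :=
    { (inferInstance : Group S.StructureGroup) with mul_comm := S.mul_comm_of_commute_ι hc }
  have hι : ∀ x x' : X, S.orbitSetoid x x' → S.ι x = S.ι x' := by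
    intro x x' h
    induction h with
    | rel x x' h =>
      obtain ⟨z, rfl | rfl⟩ := h
      exacts [(S.ι_σ_of_ι_τ hc hτ z x).symm, (hτ x z).symm]
    | refl => rfl
    | symm _ _ _ ih => exact ih.symm
    | trans _ _ _ _ _ ih ih' => exact ih.trans ih'
  let g : S.Orbits → S.StructureGroup := Quotient.lift S.ι hι
  let inv : Multiplicative (Fin S.numOrbits → ℤ) →* S.StructureGroup :=
    { toFun v := ∏ i, g (e.symm i) ^ v.toAdd i
      map_one' := by simp
      map_mul' v w := by simp [zpow_add, Finset.prod_mul_distrib] }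
  have inv_single (i) : inv (Multiplicative.ofAdd (Pi.single i 1)) = g (e.symm i) := by
    change ∏ j, g (e.symm j) ^ (Pi.single i 1 : Fin S.numOrbits → ℤ) j = _
    rw [Finset.prod_eq_single i] <;> simp +contextual
  have left : inv.comp (S.ν e) = MonoidHom.id _ := by
    refine PresentedGroup.ext fun x => ?_
    change inv (S.ν e (S.ι x)) = S.ι x
    rw [ν_ι, inv_single, Equiv.symm_apply_apply]
    rfl
  refine ⟨Function.LeftInverse.injective (g := inv) fun a => DFunLike.congr_fun left a, fun v => ?_⟩
  have hsurj (i : Fin S.numOrbits) :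
      Multiplicative.ofAdd (Pi.single i (1 : ℤ)) ∈ (S.ν e).range := by
    obtain ⟨x, hx⟩ := Quotient.exists_rep (e.symm i)
    refine ⟨S.ι x, ?_⟩
    rw [ν_ι, show S.orbitOf x = e.symm i from hx, Equiv.apply_symm_apply]
  have hv : v = ∏ i, Multiplicative.ofAdd (Pi.single i (1 : ℤ)) ^ v.toAdd i := by
    apply Multiplicative.toAdd.injective
    ext j
    simp [Finset.sum_apply, Pi.single_apply]
  rw [hv]
  exact Subgroup.prod_mem _ fun i _ => Subgroup.zpow_mem _ (hsurj i) _

/-! ### Orbits of the structure rack -/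

/-- Each `τ z` is thus a rack automorphism and permutes the rack orbits. -/
theorem τ_rackOp (x y z : X) : S.τ z (S.rackOp x y) = S.rackOp (S.τ z x) (S.τ z y) := by
  obtain ⟨u, rfl⟩ := (S.τ x).surjective y
  have h : (S.τ (S.τ z x)).symm (S.τ z (S.τ x u)) = S.τ (S.σ x z) u := by
    rw [τ_comp, Equiv.symm_apply_apply]
  rw [rackOp, rackOp, h, Equiv.symm_apply_apply, τ_comp, τ_σ_comp]

theorem rackOp_τ (x y : X) : S.rackOp y (S.τ y x) = S.τ (S.τ y x) (S.σ x y) := by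
  rw [rackOp, Equiv.symm_apply_apply]

theorem rackOrbitSetoid_le : S.rackOrbitSetoid ≤ S.orbitSetoid := by
  intro x x' h
  induction h with
  | rel x x' h =>
    obtain ⟨z, rfl⟩ := h
    exact .trans _ _ _ (.rel _ _ ⟨(S.τ x).symm z, .inl rfl⟩) (.rel _ _ ⟨z, .inr rfl⟩)
  | refl => exact .refl _
  | symm _ _ _ ih => exact .symm _ _ ih
  | trans _ _ _ _ _ ih ih' => exact .trans _ _ _ ih ih'

/-- The rack orbit of an element of the solution. -/
def rackOrbitOf (x : X) : S.RackOrbits := Quotient.mk S.rackOrbitSetoid x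

theorem rackOrbitOf_rackOp (x y : X) : S.rackOrbitOf (S.rackOp x y) = S.rackOrbitOf x :=
  (Quotient.sound (s := S.rackOrbitSetoid) (Relation.EqvGen.rel _ _ ⟨y, rfl⟩)).symm

theorem rackOrbitOf_τ_congr (z : X) {x x' : X} (h : S.rackOrbitSetoid x x') :
    S.rackOrbitOf (S.τ z x) = S.rackOrbitOf (S.τ z x') := by
  induction h with
  | rel x x' h =>
    obtain ⟨y, rfl⟩ := h
    rw [τ_rackOp, rackOrbitOf_rackOp]
  | refl => rfl
  | symm _ _ _ ih => exact ih.symm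
  | trans _ _ _ _ _ ih ih' => exact ih.trans ih'

/-- The permutation of the rack orbits induced by `τ z`. -/
noncomputable def rackOrbitPerm [Finite X] (z : X) : Equiv.Perm S.RackOrbits :=
  Equiv.ofBijective (Quotient.lift (fun x => S.rackOrbitOf (S.τ z x))
    fun _ _ h => S.rackOrbitOf_τ_congr z h) <| Finite.surjective_iff_bijective.1 fun q => by
      obtain ⟨x, rfl⟩ := Quotient.exists_rep q
      exact ⟨S.rackOrbitOf ((S.τ z).symm x), congrArg S.rackOrbitOf ((S.τ z).apply_symm_apply x)⟩

theorem rackOrbitPerm_rackOrbitOf [Finite X] (z x : X) :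
    S.rackOrbitPerm z (S.rackOrbitOf x) = S.rackOrbitOf (S.τ z x) := rfl

/-- The affine permutation `v ↦ τ z v + [z]` of the free abelian group on the rack orbits. -/
noncomputable def affinePerm [Finite X] (z : X) : Equiv.Perm (S.RackOrbits →₀ ℤ) :=
  (Finsupp.domCongr (M := ℤ) (S.rackOrbitPerm z)).toEquiv.trans
    (Equiv.addRight (Finsupp.single (S.rackOrbitOf z) 1))

theorem affinePerm_apply [Finite X] (z : X) (v : S.RackOrbits →₀ ℤ) :
    S.affinePerm z v =
      Finsupp.equivMapDomain (S.rackOrbitPerm z) v + Finsupp.single (S.rackOrbitOf z) 1 := rfl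

/-- The linear parts agree by `τ_comp`. The translations are `[τ_y(x)] + [y]` on the left and
`[τ_y(x)] + [y ◁ τ_y(x)]` on the right, by `rackOp_τ`. -/
theorem affinePerm_comp [Finite X] (x y : X) :
    S.affinePerm y * S.affinePerm x = S.affinePerm (S.τ y x) * S.affinePerm (S.σ x y) := by
  have hperm : (S.rackOrbitPerm x).trans (S.rackOrbitPerm y) =
      (S.rackOrbitPerm (S.σ x y)).trans (S.rackOrbitPerm (S.τ y x)) := by
    ext q
    obtain ⟨w, rfl⟩ := Quotient.exists_rep q
    exact congrArg S.rackOrbitOf (S.τ_comp w x y)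
  ext1 v
  have hadd (z : X) (v w : S.RackOrbits →₀ ℤ) :
      Finsupp.equivMapDomain (S.rackOrbitPerm z) (v + w) =
        Finsupp.equivMapDomain (S.rackOrbitPerm z) v +
          Finsupp.equivMapDomain (S.rackOrbitPerm z) w :=
    map_add (Finsupp.domCongr (M := ℤ) (S.rackOrbitPerm z)) v w
  simp only [Equiv.Perm.mul_apply, affinePerm_apply, hadd, Finsupp.equivMapDomain_single,
    rackOrbitPerm_rackOrbitOf, ← Finsupp.equivMapDomain_trans, hperm, ← rackOp_τ,
    rackOrbitOf_rackOp]
  rw [add_right_comm]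

/-- The right action of the structure group on the free abelian group on the rack orbits by
affine permutations. -/
noncomputable def affineHom [Finite X] :
    S.StructureGroup →* (Equiv.Perm (S.RackOrbits →₀ ℤ))ᵐᵒᵖ :=
  PresentedGroup.toGroup (f := fun x => MulOpposite.op (S.affinePerm x)) <| by
    rintro w ⟨x, y, rfl⟩
    simp only [map_mul, map_inv, FreeGroup.lift_apply_of]
    rw [mul_inv_eq_one, ← MulOpposite.op_mul, ← MulOpposite.op_mul, affinePerm_comp]

/-- Elements with the same image in the structure group lie in the same rack orbit. -/
theorem rackOrbitOf_eq_of_ι_eq [Finite X] {x y : X} (h : S.ι x = S.ι y) :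
    S.rackOrbitOf x = S.rackOrbitOf y := by
  have hι (z : X) : S.affineHom (S.ι z) = MulOpposite.op (S.affinePerm z) :=
    PresentedGroup.toGroup.of _
  -- The image of the origin is the basis vector of the rack orbit.
  have h0 : S.affinePerm x 0 = S.affinePerm y 0 := by
    rw [MulOpposite.op_injective ((hι x).symm.trans ((congrArg _ h).trans (hι y)))]
  simpa [affinePerm_apply, Finsupp.single_left_inj] using h0

theorem orbitSetoid_eq_rackOrbitSetoid [Finite X] (hc : ∀ x y, Commute (S.ι x) (S.ι y))
    (hτ : ∀ x y, S.ι (S.τ y x) = S.ι x) : S.orbitSetoid = S.rackOrbitSetoid := by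
  refine le_antisymm (Setoid.eqvGen_le ?_) S.rackOrbitSetoid_le
  rintro x _ ⟨z, rfl | rfl⟩
  · exact Quotient.exact (S.rackOrbitOf_eq_of_ι_eq (S.ι_σ_of_ι_τ hc hτ z x).symm)
  · exact Quotient.exact (S.rackOrbitOf_eq_of_ι_eq (hτ x z).symm)

/-! ### Bi-orderability versus free abelianness -/

theorem commute_ι_and_ι_τ_of_isBiOrderable [Finite X] (h : IsBiOrderable S.StructureGroup) :
    (∀ x y, Commute (S.ι x) (S.ι y)) ∧ ∀ x y, S.ι (S.τ y x) = S.ι x := by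
  obtain ⟨_, h⟩ := h
  have : MulLeftStrictMono S.StructureGroup := ⟨fun c a b hab => (h a b c hab).1⟩
  have : MulRightStrictMono S.StructureGroup := ⟨fun c a b hab => (h a b c hab).2⟩
  exact ⟨S.commute_ι, S.ι_τ S.commute_ι⟩

theorem isFreeAbelian_of_isBiOrderable [Finite X] (h : IsBiOrderable S.StructureGroup) :
    IsFreeAbelian S.StructureGroup := by
  obtain ⟨hc, hτ⟩ := S.commute_ι_and_ι_τ_of_isBiOrderable h
  let e : S.Orbits ≃ Fin S.numOrbits := Finite.equivFin _
  refine ⟨S.Orbits, ⟨(MulEquiv.ofBijective (S.ν e) (S.ν_bijective hc hτ e)).trans ?_⟩⟩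
  exact AddEquiv.toMultiplicative
    ((LinearEquiv.funCongrLeft ℤ ℤ e).trans
      (Finsupp.linearEquivFunOnFinite ℤ ℤ S.Orbits).symm).toAddEquiv

end YBESolution

theorem IsFreeAbelian.isBiOrderable {G : Type u} [Group G] (h : IsFreeAbelian G) :
    IsBiOrderable G := by
  obtain ⟨I, ⟨f⟩⟩ := h
  classical
  -- Any total order on the basis makes the lexicographic order on `I →₀ ℤ` total and
  -- translation-invariant.
  let : LinearOrder I := linearOrderOfSTO WellOrderingRel
  let F : G → Lex (I →₀ ℤ) := fun a => toLex (f a).toAdd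
  have hmul (a b : G) : F (a * b) = F a + F b := by simp [F]
  have hF : Function.Injective F :=
    toLex.injective.comp (Multiplicative.toAdd.injective.comp f.injective)
  refine ⟨LinearOrder.lift' F hF, fun a b c hab => ?_⟩
  change F a < F b at hab
  change F (c * a) < F (c * b) ∧ F (a * c) < F (b * c)
  simp only [hmul]
  exact ⟨by gcongr, by gcongr⟩

theorem mainTheorem7 {X : Type u} [Finite X] (S : YBESolution X) :
    (IsBiOrderable S.StructureGroup ↔ IsFreeAbelian S.StructureGroup) ∧
    (IsFreeAbelian S.StructureGroup →
      S.orbitSetoid = S.rackOrbitSetoid ∧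
      S.numOrbits = S.numRackOrbits ∧
      ∀ e : S.Orbits ≃ Fin S.numOrbits, Function.Bijective (S.ν e)) := by
  refine ⟨⟨S.isFreeAbelian_of_isBiOrderable, IsFreeAbelian.isBiOrderable⟩, fun h => ?_⟩
  obtain ⟨hc, hτ⟩ := S.commute_ι_and_ι_τ_of_isBiOrderable h.isBiOrderable
  have horb := S.orbitSetoid_eq_rackOrbitSetoid hc hτ
  refine ⟨horb, ?_, S.ν_bijective hc hτ⟩
  rw [YBESolution.numOrbits, YBESolution.numRackOrbits, YBESolution.Orbits,
    YBESolution.RackOrbits, horb]
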